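/- For integers $d\ge 1$ and $n\ge 2$ the Hamming graph $H(d,n)$ has vertex set $\{0,1,\dots,n-1\}^d$, two vertices being adjacent if and only if they differ in exactly one coordinate. A map is a $2$-cell embedding of a graph in a compact connected surface without boundary. As usual, it is described by its flags, the triangles of the barycentric subdivision of the map: a finite non-empty set $\Phi$ with three involutions $r_0,r_1,r_2$ of $\Phi$ that generate a transitive group, where $r_0$, $r_1$, $r_2$ send a flag to the neighbouring flag that differs from it only in the vertex, only in the edge, only in the face, respectively, so that $r_0r_2=r_2r_0$ and none of $r_0,r_1,r_2,r_0r_2$ has a fixed point. The vertices and edges of the map are the orbits of $\langle r_1,r_2\rangle$ and of $\langle r_0,r_2\rangle$ on $\Phi$, and the edge containing a flag $x$ joins the vertices containing $x$ and $r_0x$; the map is an embedding of a graph $K$ if the graph so obtained is isomorphic to $K$. An automorphism of the map is a permutation of $\Phi$ that commutes with $r_0,r_1,r_2$, and the map is regular if its automorphisms act regularly (that is, simply transitively) on $\Phi$. The map is orientable if its surface is, that is, if $\Phi$ can be divided into two classes that are interchanged by each of $r_0,r_1,r_2$; otherwise it is nonorientable. **Corollary.** Let $d\ge 2$ and $n\ge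 3$. If there is a nonorientable regular map that is an embedding of $H(d,n)$, then $n=3$, $n=4$ or $n=6$. -/

import Mathlib

/-- The Hamming graph `H(d, n)`: vertices are the `d`-tuples over an `n`-element set, and two
tuples are adjacent when they agree in all coordinates except exactly one. -/
def hammingGraph (d n : ℕ) : SimpleGraph (Fin d → Fin n) where
  Adj u v := ∃! i, u i ≠ v i
  symm := ⟨fun _ _ ⟨i, hi, h⟩ => ⟨i, Ne.symm hi, fun j hj => h j (Ne.symm hj)⟩⟩
  loopless := ⟨fun _ ⟨_, hi, _⟩ => hi rfl⟩

/-- A map, that is, a 2-cell embedding of a graph in a compact connected surface without boundary,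
given by its set `Φ` of flags.  The flags are the triangles of the barycentric subdivision of the
map; each has one corner at a vertex, one at the midpoint of an edge and one at the centre of a
face.  The surface is put together from these triangles: `r₀ x`, `r₁ x` and `r₂ x` are
the triangles that are glued to `x` along the side opposite its vertex corner, its edge corner and
its face corner, so that `r₀`, `r₁`, `r₂` change only the vertex, only the edge, only the face.
No side is on a boundary, four different triangles meet around the midpoint of an edge, and the
surface is connected and made of finitely many triangles. -/
structure CombinatorialMap (Φ : Type*) where
  r₀ : Equiv.Perm Φ
  r₁ : Equiv.Perm Φ
  r₂ : Equiv.Perm Φ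
  r₀_r₀ : ∀ x, r₀ (r₀ x) = x
  r₁_r₁ : ∀ x, r₁ (r₁ x) = x
  r₂_r₂ : ∀ x, r₂ (r₂ x) = x
  r₀_ne : ∀ x, r₀ x ≠ x
  r₁_ne : ∀ x, r₁ x ≠ x
  r₂_ne : ∀ x, r₂ x ≠ x
  r₀_r₂ : ∀ x, r₀ (r₂ x) = r₂ (r₀ x)
  r₀_r₂_ne : ∀ x, r₀ (r₂ x) ≠ x
  finite : Finite Φ
  nonempty : Nonempty Φ
  connected : MulAction.IsPretransitive (Subgroup.closure {r₀, r₁, r₂}) Φ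

namespace CombinatorialMap

variable {Φ : Type*} (M : CombinatorialMap Φ)

/-- The vertices of the map: the classes of flags that go around a common vertex. -/
abbrev Vertex : Type _ := MulAction.orbitRel.Quotient (Subgroup.closure {M.r₁, M.r₂}) Φ

/-- The edges of the map: the classes of the (four) flags that go around a common edge. -/
abbrev Edge : Type _ := MulAction.orbitRel.Quotient (Subgroup.closure {M.r₀, M.r₂}) Φ

/-- The vertex of a flag. -/
def vertexOf (x : Φ) : M.Vertex := Quotient.mk _ x

/-- The edge of a flag. -/
def edgeOf (x : Φ) : M.Edge := Quotient.mk _ x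

/-- The map is an embedding of the graph `G`: its underlying graph, in which the edge of a flag `x`
joins the vertices of `x` and of `r₀ x`, is isomorphic to `G`.  (The underlying graph might a priori
have loops or multiple edges, so an isomorphism is a bijection of vertices together with a bijection
of edges that respects the end vertices.) -/
def IsEmbeddingOf {V : Type*} (G : SimpleGraph V) : Prop :=
  ∃ (f : M.Vertex ≃ V) (g : M.Edge ≃ G.edgeSet),
    ∀ x, (g (M.edgeOf x) : Sym2 V) = s(f (M.vertexOf x), f (M.vertexOf (M.r₀ x)))

/-- An automorphism of the map: a permutation of the flags that preserves the three relations of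
being adjacent flags (differing only in the vertex, only in the edge, only in the face). -/
def IsAutomorphism (g : Equiv.Perm Φ) : Prop :=
  ∀ x, g (M.r₀ x) = M.r₀ (g x) ∧ g (M.r₁ x) = M.r₁ (g x) ∧ g (M.r₂ x) = M.r₂ (g x)

/-- The map is regular: its automorphisms act regularly on the flags. -/
def IsRegular : Prop :=
  ∀ x y, ∃! g : Equiv.Perm Φ, M.IsAutomorphism g ∧ g x = y

/-- The surface of the map is orientable: the triangles can be oriented coherently.  Here `o x` says
whether the chosen orientation of the triangle `x` is the one that runs through its corners in the
order vertex, edge, face.  Since two triangles with a common side have the same two types of corners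
on it, their orientations are coherent exactly when `o` takes different values on them. -/
def IsOrientable : Prop :=
  ∃ o : Φ → Bool, ∀ x, o (M.r₀ x) ≠ o x ∧ o (M.r₁ x) ≠ o x ∧ o (M.r₂ x) ≠ o x

end CombinatorialMap

/-!
Let `K` be a line of the Hamming graph: a clique of `n = m + 1` vertices such that no vertex outside
`K` has two neighbours in `K`. For `n = 3` there is nothing to show, so let `m ≥ 3`.

In a regular map the automorphisms fixing a vertex `v` act on the neighbours of `v`, in their cyclic
order, as a full dihedral group. An automorphism that maps two vertices of `K` into `K` preserves `K`.
Hence the neighbours of `v ∈ K` that lie in `K` are equally spaced in the cyclic order, and the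
stabilizer of `v` and `K` acts on them as the dihedral group of degree `m`
(`CombinatorialMap.IsLabelling.exists_dihedral`). On the other hand, since an automorphism is
determined by the image of one flag, at most two automorphisms interchange two given adjacent vertices
(`CombinatorialMap.IsLabelling.exists_swaps`).

These two facts bound `m` by a double count of the pairs of points of `K` interchanged by elements of
the point stabilizers (`eq_three_or_five_of_dihedral`), in which an automorphism is to be counted
once for each of its fixed points in `K`. There are `(m + 1) m` ordered pairs of different points, so
at most `2 (m + 1) m` incidences of an automorphism with an ordered pair it interchanges.

* If `m` is odd, a reflection of the `m`-gon at `v` fixes `v` and one more point of `K`. The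
  `(m + 1) m` pairs of a vertex and a reflection at it give `m - 1` interchanged ordered pairs each,
  and each incidence comes from two vertices, so
  `(m + 1) m (m - 1) ≤ 4 (m + 1) m`, and `m` is `3` or `5`.
* If `m` is even, the half turn and two of the reflections at `v`, `j ↦ 1 - j` and
  `j ↦ -1 - j`, are involutions fixing no point of `K` but `v`. They interchange `m` ordered pairs
  each, so `3 (m + 1) m ≤ 2 (m + 1) m`, which is absurd.
-/

/-! ### Counting in dihedral point stabilizers -/

/-- An affine function `j ↦ c ± j` of `ZMod m`, that is, an element of the dihedral group of the
`m`-gon: the reflection `j ↦ c - j` if `s` is true, the rotation `j ↦ c + j` otherwise. -/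
def dihedralFun {m : ℕ} (s : Bool) (c j : ZMod m) : ZMod m := if s then c - j else c + j

theorem dihedralFun_dihedralFun_true {m : ℕ} (c j : ZMod m) :
    dihedralFun true c (dihedralFun true c j) = j := by
  simp [dihedralFun]

theorem two_ne_zero_of_three_le {m : ℕ} (hm : 3 ≤ m) : (2 : ZMod m) ≠ 0 := by
  intro h
  have h2 : ((2 : ℕ) : ZMod m) = 0 := by exact_mod_cast h
  rw [ZMod.natCast_eq_zero_iff] at h2
  exact absurd (Nat.le_of_dvd (by norm_num) h2) (by omega)

theorem dihedralFun_injective {m : ℕ} (hm : 3 ≤ m) {s s' : Bool} {c c' : ZMod m}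
    (h : ∀ j, dihedralFun s c j = dihedralFun s' c' j) : s = s' ∧ c = c' := by
  have h2 := two_ne_zero_of_three_le hm
  have h0 := h 0
  have h1 := h 1
  have hc : c = c' := by cases s <;> cases s' <;> simpa [dihedralFun] using h0
  subst hc
  refine ⟨?_, rfl⟩
  cases s <;> cases s' <;> simp only [dihedralFun, if_true, Bool.false_eq_true, if_false] at h1 ⊢
  · exact absurd (by linear_combination h1) h2
  · exact absurd (by linear_combination -h1) h2

/-- A double count: if every pair of different points of `K` is interchanged by at most two
elements of `G`, then a family of elements with pairs that they interchange, in which no element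
occurs more than `k` times with the same pair, has at most `k` times twice the number of pairs
as members. -/
theorem card_le_of_swaps {G V ι : Type*} [Nonempty G] [DecidableEq V] (K : Finset V)
    (act : G → V → V)
    (hswap : ∀ a ∈ K, ∀ b ∈ K, a ≠ b →
      ∃ g₁ g₂, ∀ g, act g a = b → act g b = a → g = g₁ ∨ g = g₂)
    (P : Finset ι) (g : ι → G) (a b : ι → V) (k : ℕ)
    (hP : ∀ p ∈ P, a p ∈ K ∧ b p ∈ K ∧ a p ≠ b p ∧ act (g p) (a p) = b p ∧ act (g p) (b p) = a p)
    (hfib : ∀ Q ⊆ P, (∀ p ∈ Q, ∀ q ∈ Q, g p = g q ∧ a p = a q ∧ b p = b q) → Q.card ≤ k) :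
    P.card ≤ k * (K.offDiag.card * 2) := by
  classical
  choose! g₁ g₂ hg using hswap
  have h2 : K.offDiag.card * 2 = (K.offDiag ×ˢ (Finset.univ : Finset Bool)).card := by
    simp [Finset.card_product]
  rw [h2]
  refine Finset.card_le_mul_card_image_of_maps_to
    (f := fun p => ((a p, b p), decide (g p = g₁ (a p) (b p)))) ?_ k ?_
  · intro p hp
    obtain ⟨h1, h2, h3, -⟩ := hP p hp
    simp [Finset.mem_product, Finset.mem_offDiag, h1, h2, h3, em]
  · intro y _
    refine hfib _ (Finset.filter_subset _ _) ?_
    intro p hp q hq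
    rw [Finset.mem_filter] at hp hq
    have e := hp.2.trans hq.2.symm
    simp only [Prod.mk.injEq] at e
    obtain ⟨⟨ea, eb⟩, ed⟩ := e
    refine ⟨?_, ea, eb⟩
    obtain ⟨p1, p2, p3, p4, p5⟩ := hP p hp.1
    obtain ⟨q1, q2, q3, q4, q5⟩ := hP q hq.1
    rw [← ea, ← eb] at ed q4 q5
    have hp' := hg _ p1 _ p2 p3 _ p4 p5
    have hq' := hg _ p1 _ p2 p3 _ q4 q5
    by_cases h : g p = g₁ (a p) (b p)
    · have h' : g q = g₁ (a p) (b p) := by simpa [h] using ed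
      rw [h, h']
    · have h' : g q ≠ g₁ (a p) (b p) := by simpa [h] using ed
      rw [hp'.resolve_left h, hq'.resolve_left h']

/-- A set of `m + 1 ≥ 4` points, on which dihedral groups of degree `m` act as point stabilizers
and any two points are interchanged by at most two elements, has four or six points. -/
theorem eq_three_or_five_of_dihedral {G V : Type*} [Nonempty G] {m : ℕ} (hm : 3 ≤ m) (K : Finset V)
    (hK : K.card = m + 1) (act : G → V → V)
    (hswap : ∀ a ∈ K, ∀ b ∈ K, a ≠ b →
      ∃ g₁ g₂, ∀ g, act g a = b → act g b = a → g = g₁ ∨ g = g₂)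
    (hdih : ∀ v ∈ K, ∃ φ : ZMod m → V, Function.Injective φ ∧
      (∀ w, (w ∈ K ∧ w ≠ v) ↔ ∃ j, φ j = w) ∧
      ∀ s c, ∃ g, act g v = v ∧ ∀ j, act g (φ j) = φ (dihedralFun s c j)) :
    m = 3 ∨ m = 5 := by
  classical
  have : NeZero m := ⟨by omega⟩
  choose! φ hinj hrange el hfix hact using hdih
  have hoff : K.offDiag.card = (m + 1) * m := by
    rw [Finset.offDiag_card, hK, Nat.mul_add]
    simp
  have h2 := two_ne_zero_of_three_le hm
  have hmem : ∀ v ∈ K, ∀ j, φ v j ∈ K := fun v hv j => ((hrange v hv _).2 ⟨j, rfl⟩).1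
  rcases Nat.even_or_odd m with hev | hodd
  · exfalso
    obtain ⟨h, hh⟩ := hev
    have hh0 : (h : ZMod m) + h = 0 := by
      have : ((h + h : ℕ) : ZMod m) = 0 := by rw [← hh]; simp
      simpa using this
    have hhne : (h : ZMod m) ≠ 0 := by
      rw [Ne, ZMod.natCast_eq_zero_iff]
      intro hd
      exact absurd (Nat.le_of_dvd (by omega) hd) (by omega)
    -- Multiplying by `m / 2` detects parity.
    have hodd1 : ∀ j : ZMod m, j + j ≠ 1 := by
      intro j hj
      apply hhne
      linear_combination (-(h : ZMod m)) * hj + j * hh0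
    have hodd2 : ∀ j : ZMod m, j + j ≠ -1 := by
      intro j hj
      apply hodd1 (-j)
      linear_combination -hj
    -- Three elements of the dihedral group without fixed points whose squares are trivial.
    let S : Finset (Bool × ZMod m) := {(false, (h : ZMod m)), (true, 1), (true, -1)}
    have hScard : S.card = 3 := by
      have h11 : (1 : ZMod m) ≠ -1 := fun h => h2 (by linear_combination h)
      rw [Finset.card_eq_three]
      exact ⟨_, _, _, by simp, by simp, by simpa using h11, rfl⟩
    have hS : ∀ t ∈ S, ∀ j, dihedralFun t.1 t.2 j ≠ j ∧
        dihedralFun t.1 t.2 (dihedralFun t.1 t.2 j) = j := by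
      intro t ht j
      simp only [S, Finset.mem_insert, Finset.mem_singleton] at ht
      rcases ht with rfl | rfl | rfl
      · refine ⟨by simpa [dihedralFun] using hhne, ?_⟩
        simp only [dihedralFun, Bool.false_eq_true, if_false]
        linear_combination hh0
      · refine ⟨fun e => hodd1 j ?_, dihedralFun_dihedralFun_true _ _⟩
        simp only [dihedralFun, if_true] at e
        linear_combination -e
      · refine ⟨fun e => hodd2 j ?_, dihedralFun_dihedralFun_true _ _⟩
        simp only [dihedralFun, if_true] at e
        linear_combination -e
    have key := card_le_of_swaps K act hswap (K ×ˢ S ×ˢ (Finset.univ : Finset (ZMod m)))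
      (fun p => el p.1 p.2.1.1 p.2.1.2) (fun p => φ p.1 p.2.2)
      (fun p => φ p.1 (dihedralFun p.2.1.1 p.2.1.2 p.2.2)) 1 ?_ ?_
    · rw [Finset.card_product, Finset.card_product, hScard, hoff, hK, Finset.card_univ,
        ZMod.card] at key
      have : 0 < (m + 1) * m := by positivity
      nlinarith
    · rintro ⟨v, t, j⟩ hp
      simp only [Finset.mem_product, Finset.mem_univ, and_true] at hp
      obtain ⟨hv, ht⟩ := hp
      refine ⟨hmem v hv _, hmem v hv _, fun e => (hS t ht j).1 (hinj v hv e).symm,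
        hact v hv _ _ _, ?_⟩
      simp only [hact v hv, (hS t ht j).2]
    · intro Q hQ hQe
      rw [Finset.card_le_one]
      rintro ⟨v, t, j⟩ hp ⟨v', t', j'⟩ hq
      obtain ⟨eg, ea, -⟩ := hQe _ hp _ hq
      have hp' := hQ hp
      have hq' := hQ hq
      simp only [Finset.mem_product, Finset.mem_univ, and_true] at hp' hq' eg ea
      have hvv : v' = v := by
        by_contra hne
        obtain ⟨i, hi⟩ := (hrange v hp'.1 v').1 ⟨hq'.1, hne⟩
        have e1 := hfix v' hq'.1 t'.1 t'.2
        rw [← eg, ← hi, hact v hp'.1] at e1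
        exact (hS t hp'.2 i).1 (hinj v hp'.1 e1)
      subst hvv
      have hj := hinj _ hp'.1 ea
      subst hj
      have ht : t.1 = t'.1 ∧ t.2 = t'.2 := by
        apply dihedralFun_injective hm
        intro i
        apply hinj _ hp'.1
        rw [← hact _ hp'.1, ← hact _ hp'.1, eg]
      rw [Prod.ext ht.1 ht.2]
  · have hcancel : ∀ i j : ZMod m, i + i = j + j → i = j := by
      intro i j hij
      obtain ⟨h, hh⟩ := hodd
      have hh0 : 2 * (h : ZMod m) + 1 = 0 := by
        have : ((2 * h + 1 : ℕ) : ZMod m) = 0 := by rw [← hh]; simp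
        simpa using this
      linear_combination (-(h : ZMod m)) * hij + (i - j) * hh0
    have key := card_le_of_swaps K act hswap
      (K ×ˢ (Finset.univ.erase (0 : ZMod m)) ×ˢ (Finset.univ : Finset (ZMod m)))
      (fun p => el p.1 true (p.2.1 + (p.2.2 + p.2.2))) (fun p => φ p.1 p.2.2)
      (fun p => φ p.1 (p.2.1 + p.2.2)) 2 ?_ ?_
    · rw [Finset.card_product, Finset.card_product, hoff, hK, Finset.card_univ,
        Finset.card_erase_of_mem (Finset.mem_univ _), Finset.card_univ, ZMod.card] at key
      have hpos : 0 < (m + 1) * m := by positivity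
      have h4 : (m + 1) * m * (m - 1) ≤ (m + 1) * m * 4 := by
        calc (m + 1) * m * (m - 1) = (m + 1) * ((m - 1) * m) := by ring
          _ ≤ 2 * ((m + 1) * m * 2) := key
          _ = (m + 1) * m * 4 := by ring
      have := Nat.le_of_mul_le_mul_left h4 hpos
      obtain ⟨h, hh⟩ := hodd
      omega
    · rintro ⟨v, e, j⟩ hp
      simp only [Finset.mem_product, Finset.mem_univ, and_true, Finset.mem_erase] at hp
      obtain ⟨hv, he⟩ := hp
      refine ⟨hmem v hv _, hmem v hv _, fun h => he ?_, ?_, ?_⟩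
      · simpa using hinj v hv h
      · simp only [hact v hv, dihedralFun, if_true]
        congr 1
        ring
      · simp only [hact v hv, dihedralFun, if_true]
        congr 1
        ring
    · intro Q hQ hQe
      by_contra hlt
      rw [not_le, Finset.two_lt_card] at hlt
      obtain ⟨⟨v, c, j⟩, hp, q, hq, r, hr, hpq, hpr, hqr⟩ := hlt
      have hmemK : ∀ q ∈ Q, q.1 ∈ K := fun q hq => by
        have := hQ hq
        simp only [Finset.mem_product] at this
        exact this.1
      -- The base point of a member with given element and pair determines the member.
      have hfst : ∀ q ∈ Q, ∀ r ∈ Q, q.1 = r.1 → q = r := by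
        rintro ⟨v, e, j⟩ hq ⟨v', e', j'⟩ hr hv
        obtain ⟨-, ea, eb⟩ := hQe _ hq _ hr
        simp only at hv ea eb
        subst hv
        have hvK := hmemK _ hq
        have hj := hinj _ hvK ea
        subst hj
        have := hinj _ hvK eb
        rw [add_right_cancel this]
      have hv := hmemK _ hp
      -- Every base point is a fixed point of the reflection, and those other than `v` are all equal.
      have hfixed : ∀ q ∈ Q, (v, c, j) ≠ q → ∃ i, φ v i = q.1 ∧ i + i = c + (j + j) := by
        intro q hq hne
        have hne' : q.1 ≠ v := fun h => hne (hfst _ hp _ hq h.symm)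
        obtain ⟨i, hi⟩ := (hrange v hv q.1).1 ⟨hmemK q hq, hne'⟩
        refine ⟨i, hi, ?_⟩
        have e1 := hfix q.1 (hmemK q hq) true (q.2.1 + (q.2.2 + q.2.2))
        rw [← (hQe _ hp _ hq).1, ← hi, hact v hv] at e1
        have e2 := hinj v hv e1
        simp only [dihedralFun, if_true] at e2
        linear_combination -e2
      obtain ⟨i, hi, hi'⟩ := hfixed q hq hpq
      obtain ⟨i', hi1, hi1'⟩ := hfixed r hr hpr
      have := hcancel i i' (hi'.trans hi1'.symm)
      exact hqr (hfst _ hq _ hr (by rw [← hi, ← hi1, this]))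

/-! ### The flags at a vertex and at an edge -/

namespace CombinatorialMap

variable {Φ : Type*} (M : CombinatorialMap Φ)

theorem r₀_mul_r₀ : M.r₀ * M.r₀ = 1 := Equiv.ext M.r₀_r₀

theorem r₁_mul_r₁ : M.r₁ * M.r₁ = 1 := Equiv.ext M.r₁_r₁

theorem r₂_mul_r₂ : M.r₂ * M.r₂ = 1 := Equiv.ext M.r₂_r₂

theorem inv_r₁ : M.r₁⁻¹ = M.r₁ := inv_eq_of_mul_eq_one_left M.r₁_mul_r₁

theorem inv_r₂ : M.r₂⁻¹ = M.r₂ := inv_eq_of_mul_eq_one_left M.r₂_mul_r₂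

/-- The permutation of the flags that turns each flag one edge further around its vertex. -/
def turn : Equiv.Perm Φ := M.r₁ * M.r₂

theorem semiconjBy_r₂_turn : SemiconjBy M.r₂ M.turn M.turn⁻¹ := by
  simp only [SemiconjBy, turn, mul_inv_rev, inv_r₁, inv_r₂, mul_assoc]

theorem r₂_mul_turn_zpow (i : ℤ) : M.r₂ * M.turn ^ i = M.turn ^ (-i) * M.r₂ := by
  have := (M.semiconjBy_r₂_turn.zpow_right i).eq
  rwa [inv_zpow'] at this

theorem r₂_turn_zpow (i : ℤ) (x : Φ) : M.r₂ ((M.turn ^ i) x) = (M.turn ^ (-i)) (M.r₂ x) :=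
  congrArg (fun p : Equiv.Perm Φ => p x) (M.r₂_mul_turn_zpow i)

theorem turn_zpow_add (i j : ℤ) (x : Φ) :
    (M.turn ^ (i + j)) x = (M.turn ^ i) ((M.turn ^ j) x) := by
  rw [zpow_add]; rfl

theorem r₁_r₂_turn_zpow (i : ℤ) (x : Φ) :
    M.r₁ (M.r₂ ((M.turn ^ i) x)) = (M.turn ^ (i + 1)) x := by
  rw [add_comm, turn_zpow_add, zpow_one]; rfl

/-- The reflections among the dihedral group `⟨r₁, r₂⟩` have no fixed points, since each is conjugate
to `r₁` or to `r₂`. -/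
theorem r₂_turn_zpow_ne (i : ℤ) (x : Φ) : M.r₂ ((M.turn ^ i) x) ≠ x := by
  intro h
  rcases Int.even_or_odd' i with ⟨k, rfl | rfl⟩
  · apply M.r₂_ne ((M.turn ^ k) x)
    rw [r₂_turn_zpow] at h ⊢
    calc (M.turn ^ (-k)) (M.r₂ x) = (M.turn ^ (k + -(2 * k))) (M.r₂ x) := by congr 2; ring
      _ = (M.turn ^ k) x := by rw [turn_zpow_add, h]
  · apply M.r₁_ne ((M.turn ^ (k + 1)) x)
    have h' : M.r₂ ((M.turn ^ k) x) = (M.turn ^ (k + 1)) x := by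
      rw [r₂_turn_zpow] at h ⊢
      calc (M.turn ^ (-k)) (M.r₂ x)
          = (M.turn ^ (k + 1 + -(2 * k + 1))) (M.r₂ x) := by congr 2; ring
        _ = (M.turn ^ (k + 1)) x := by rw [turn_zpow_add, h]
    rw [← h', r₁_r₂_turn_zpow, h']

/-- The dihedral group `⟨r₁, r₂⟩` consists of rotations and reflections. -/
theorem mem_closure_r₁_r₂ {p : Equiv.Perm Φ} (hp : p ∈ Subgroup.closure {M.r₁, M.r₂}) :
    ∃ i : ℤ, p = M.turn ^ i ∨ p = M.r₂ * M.turn ^ i := by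
  have h22 : ∀ q, M.r₂ * (M.r₂ * q) = q := fun q => by rw [← mul_assoc, r₂_mul_r₂, one_mul]
  induction hp using Subgroup.closure_induction with
  | mem p hp =>
    rcases hp with rfl | rfl
    · refine ⟨-1, Or.inr ?_⟩
      rw [r₂_mul_turn_zpow, neg_neg, zpow_one, turn, mul_assoc, r₂_mul_r₂, mul_one]
    · exact ⟨0, Or.inr (by simp)⟩
  | one => exact ⟨0, Or.inl (by simp)⟩
  | mul p q _ _ hp hq =>
    obtain ⟨i, rfl | rfl⟩ := hp <;> obtain ⟨j, rfl | rfl⟩ := hq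
    · exact ⟨i + j, Or.inl (zpow_add _ _ _).symm⟩
    · refine ⟨-i + j, Or.inr ?_⟩
      rw [zpow_add, ← mul_assoc, ← mul_assoc, r₂_mul_turn_zpow, neg_neg]
    · exact ⟨i + j, Or.inr (by rw [zpow_add, mul_assoc])⟩
    · refine ⟨-i + j, Or.inl ?_⟩
      rw [mul_assoc, ← mul_assoc _ M.r₂, ← neg_neg i, ← r₂_mul_turn_zpow, mul_assoc, h22,
        ← zpow_add, neg_neg]
  | inv p _ hp =>
    obtain ⟨i, rfl | rfl⟩ := hp
    · exact ⟨-i, Or.inl (zpow_neg _ _).symm⟩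
    · exact ⟨i, Or.inr (by rw [mul_inv_rev, inv_r₂, r₂_mul_turn_zpow, zpow_neg])⟩

theorem vertexOf_eq_iff {x y : Φ} :
    M.vertexOf x = M.vertexOf y ↔
      ∃ i : ℤ, y = (M.turn ^ i) x ∨ y = M.r₂ ((M.turn ^ i) x) := by
  have h1 : M.r₁ ∈ Subgroup.closure {M.r₁, M.r₂} := Subgroup.subset_closure (by simp)
  have h2 : M.r₂ ∈ Subgroup.closure {M.r₁, M.r₂} := Subgroup.subset_closure (by simp)
  have ht : ∀ i : ℤ, M.turn ^ i ∈ Subgroup.closure {M.r₁, M.r₂} :=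
    fun i => Subgroup.zpow_mem _ (mul_mem h1 h2) i
  rw [eq_comm, vertexOf, vertexOf, Quotient.eq, MulAction.orbitRel_apply]
  constructor
  · rintro ⟨⟨p, hp⟩, rfl⟩
    obtain ⟨i, rfl | rfl⟩ := M.mem_closure_r₁_r₂ hp
    · exact ⟨i, Or.inl rfl⟩
    · exact ⟨i, Or.inr rfl⟩
  · rintro ⟨i, rfl | rfl⟩
    · exact ⟨⟨_, ht i⟩, rfl⟩
    · exact ⟨⟨_, mul_mem h2 (ht i)⟩, rfl⟩

theorem eq_of_edgeOf_eq {x y : Φ} (h : M.edgeOf x = M.edgeOf y) :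
    (y = x ∨ y = M.r₂ x) ∨ y = M.r₀ x ∨ y = M.r₀ (M.r₂ x) := by
  symm at h
  rw [edgeOf, edgeOf, Quotient.eq, MulAction.orbitRel_apply] at h
  obtain ⟨⟨p, hp⟩, rfl⟩ := h
  have key : ∀ x, (p x = x ∨ p x = M.r₂ x) ∨ p x = M.r₀ x ∨ p x = M.r₀ (M.r₂ x) := by
    have hinv : M.r₀⁻¹ = M.r₀ := inv_eq_of_mul_eq_one_left M.r₀_mul_r₀
    induction hp using Subgroup.closure_induction'' with
    | mem p hp => rcases hp with rfl | rfl <;> simp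
    | inv_mem p hp => rcases hp with rfl | rfl <;> simp [hinv, inv_r₂]
    | one => simp
    | mul p q _ _ hp hq =>
      intro x
      rw [Equiv.Perm.mul_apply]
      rcases hq x with (h | h) | h | h <;> rw [h] <;>
        rcases hp x with (h | h) | h | h <;> 
        first
        | simpa [r₀_r₀, r₂_r₂, r₀_r₂] using hp x
        | simpa [r₀_r₀, r₂_r₂, r₀_r₂, or_comm, or_left_comm] using hp (M.r₂ x)
        | simpa [r₀_r₀, r₂_r₂, r₀_r₂, or_comm, or_left_comm] using hp (M.r₀ x)
        | simpa [r₀_r₀, r₂_r₂, r₀_r₂, or_comm, or_left_comm] using hp (M.r₀ (M.r₂ x))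
  exact key x

/-- A labelling of the flags of a map by the vertices of a simple graph `G`, which gives an embedding
of `G`: `pt x` is the vertex of the flag `x`, and `pt (r₀ x)` is the other end of its edge. -/
structure IsLabelling {V : Type*} (G : SimpleGraph V) (pt : Φ → V) : Prop where
  pt_eq_iff : ∀ x y, pt x = pt y ↔ ∃ i : ℤ, y = (M.turn ^ i) x ∨ y = M.r₂ ((M.turn ^ i) x)
  adj : ∀ x, G.Adj (pt x) (pt (M.r₀ x))
  surjective : Function.Surjective pt
  exists_of_adj : ∀ u v, G.Adj u v → ∃ x, pt x = u ∧ pt (M.r₀ x) = v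
  eq_or_eq : ∀ x y, pt x = pt y → pt (M.r₀ x) = pt (M.r₀ y) → y = x ∨ y = M.r₂ x

theorem IsEmbeddingOf.exists_isLabelling {V : Type*} {G : SimpleGraph V}
    (hM : M.IsEmbeddingOf G) : ∃ pt, M.IsLabelling G pt := by
  obtain ⟨f, g, hfg⟩ := hM
  have hadj : ∀ x, G.Adj (f (M.vertexOf x)) (f (M.vertexOf (M.r₀ x))) := by
    intro x
    rw [← SimpleGraph.mem_edgeSet, ← hfg]
    exact (g _).2
  refine ⟨fun x => f (M.vertexOf x), ?_, hadj, ?_, ?_, ?_⟩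
  · intro x y
    rw [f.apply_eq_iff_eq, vertexOf_eq_iff]
  · exact f.surjective.comp Quotient.mk_surjective
  · intro u v huv
    obtain ⟨e, he⟩ := g.surjective ⟨s(u, v), huv⟩
    obtain ⟨x, rfl⟩ := Quotient.mk_surjective e
    have h := hfg x
    rw [edgeOf, he, Sym2.eq_iff] at h
    rcases h with ⟨h1, h2⟩ | ⟨h1, h2⟩
    · exact ⟨x, h1.symm, h2.symm⟩
    · exact ⟨M.r₀ x, h1.symm, by rw [M.r₀_r₀]; exact h2.symm⟩
  · intro x y h1 h2
    have hxy : M.edgeOf x = M.edgeOf y := by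
      apply g.injective
      apply Subtype.ext
      rw [hfg, hfg, h1, h2]
    have hr₂ : M.vertexOf (M.r₂ (M.r₀ x)) = M.vertexOf (M.r₀ x) := by
      rw [eq_comm, vertexOf_eq_iff]
      exact ⟨0, Or.inr rfl⟩
    rcases M.eq_of_edgeOf_eq hxy with h | h | h
    · exact h
    · rw [h] at h1
      exact absurd h1 (hadj x).ne
    · rw [h, r₀_r₂, hr₂] at h1
      exact absurd h1 (hadj x).ne

variable {M}

namespace IsAutomorphism

variable {h : Equiv.Perm Φ}

theorem map_turn_zpow (hh : M.IsAutomorphism h) (i : ℤ) (x : Φ) :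
    h ((M.turn ^ i) x) = (M.turn ^ i) (h x) := by
  have hc : Commute h M.turn := by
    apply Commute.mul_right
    · exact Equiv.ext fun x => (hh x).2.1
    · exact Equiv.ext fun x => (hh x).2.2
  exact congrArg (fun p : Equiv.Perm Φ => p x) (hc.zpow_right i).eq

end IsAutomorphism

end CombinatorialMap

/-! ### The vertex stabilizers of a regular map -/

namespace CombinatorialMap

variable {Φ : Type*} {M : CombinatorialMap Φ}

theorem IsRegular.eq_of_apply_eq (hreg : M.IsRegular) {g h : Equiv.Perm Φ}
    (hg : M.IsAutomorphism g) (hh : M.IsAutomorphism h) {x : Φ} (hx : g x = h x) : g = h :=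
  (hreg x (h x)).unique ⟨hg, hx⟩ ⟨hh, rfl⟩

theorem IsRegular.turn_zpow_eq_one (hreg : M.IsRegular) {i : ℤ} {x : Φ}
    (hx : (M.turn ^ i) x = x) : M.turn ^ i = 1 := by
  ext y
  obtain ⟨h, ⟨hh, rfl⟩, -⟩ := hreg x y
  rw [← hh.map_turn_zpow, hx, Equiv.Perm.one_apply]

namespace IsLabelling

variable {V : Type*} {G : SimpleGraph V} {pt : Φ → V}

/-- The permutation of the vertices that an automorphism `h` induces; the value is not meaningful
for a permutation `h` of the flags that is not an automorphism. -/
noncomputable def act (hL : M.IsLabelling G pt) (h : Equiv.Perm Φ) (v : V) : V :=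
  pt (h (Function.surjInv hL.surjective v))

theorem act_pt (hL : M.IsLabelling G pt) {h : Equiv.Perm Φ} (hh : M.IsAutomorphism h) (x : Φ) :
    hL.act h (pt x) = pt (h x) := by
  obtain ⟨i, hi⟩ := (hL.pt_eq_iff _ _).1 (Function.surjInv_eq hL.surjective (pt x))
  refine (hL.pt_eq_iff _ _).2 ⟨i, hi.imp (fun e => ?_) (fun e => ?_)⟩
  · rw [← hh.map_turn_zpow, ← e]
  · rw [← hh.map_turn_zpow, ← (hh _).2.2, ← e]

theorem act_adj (hL : M.IsLabelling G pt) {h : Equiv.Perm Φ} (hh : M.IsAutomorphism h) {u v : V}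
    (huv : G.Adj u v) : G.Adj (hL.act h u) (hL.act h v) := by
  obtain ⟨x, rfl, rfl⟩ := hL.exists_of_adj u v huv
  rw [hL.act_pt hh, hL.act_pt hh, (hh x).1]
  exact hL.adj _

theorem pt_turn_zpow (hL : M.IsLabelling G pt) (i : ℤ) (x : Φ) : pt ((M.turn ^ i) x) = pt x :=
  ((hL.pt_eq_iff _ _).2 ⟨i, Or.inl rfl⟩).symm

theorem pt_r₂ (hL : M.IsLabelling G pt) (x : Φ) : pt (M.r₂ x) = pt x :=
  ((hL.pt_eq_iff _ _).2 ⟨0, Or.inr rfl⟩).symm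

/-- At most two automorphisms interchange two given adjacent vertices: an automorphism is
determined by the image of a flag, and there are only two flags with given ends. -/
theorem exists_swaps (hL : M.IsLabelling G pt) (hreg : M.IsRegular) {a b : V} (hab : G.Adj a b) :
    ∃ g₁ g₂ : {h : Equiv.Perm Φ // M.IsAutomorphism h},
      ∀ g : {h : Equiv.Perm Φ // M.IsAutomorphism h},
        hL.act g a = b → hL.act g b = a → g = g₁ ∨ g = g₂ := by
  obtain ⟨x, rfl, rfl⟩ := hL.exists_of_adj a b hab
  obtain ⟨g₁, ⟨hg₁, h₁⟩, -⟩ := hreg x (M.r₀ x)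
  obtain ⟨g₂, ⟨hg₂, h₂⟩, -⟩ := hreg x (M.r₂ (M.r₀ x))
  refine ⟨⟨g₁, hg₁⟩, ⟨g₂, hg₂⟩, ?_⟩
  rintro ⟨g, hg⟩ ha hb
  rw [hL.act_pt hg] at ha hb
  rw [(hg x).1] at hb
  rcases hL.eq_or_eq (M.r₀ x) (g x) ha.symm (by rw [M.r₀_r₀, hb]) with h | h
  · exact Or.inl (Subtype.ext (hreg.eq_of_apply_eq hg hg₁ (h.trans h₁.symm)))
  · exact Or.inr (Subtype.ext (hreg.eq_of_apply_eq hg hg₂ (h.trans h₂.symm)))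

/-- An automorphism that maps two vertices of a clique into it preserves the clique, if no vertex
outside the clique has two neighbours in it. -/
theorem act_mem (hL : M.IsLabelling G pt) {K : Finset V}
    (hc : ∀ a ∈ K, ∀ b ∈ K, a ≠ b → G.Adj a b)
    (hmax : ∀ a ∈ K, ∀ b ∈ K, a ≠ b → ∀ w, G.Adj a w → G.Adj b w → w ∈ K)
    {h : Equiv.Perm Φ} (hh : M.IsAutomorphism h) {a b w : V} (ha : a ∈ K) (hb : b ∈ K)
    (hab : a ≠ b) (hha : hL.act h a ∈ K) (hhb : hL.act h b ∈ K) (hw : w ∈ K) :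
    hL.act h w ∈ K := by
  by_cases hwa : a = w
  · rwa [← hwa]
  by_cases hwb : b = w
  · rwa [← hwb]
  exact hmax _ hha _ hhb (hL.act_adj hh (hc a ha b hb hab)).ne _
    (hL.act_adj hh (hc a ha w hw hwa)) (hL.act_adj hh (hc b hb w hw hwb))

/-- In a regular map, the neighbours of a vertex `v`, in their cyclic order, are acted on by the
stabilizer of `v` as a dihedral group; the indices of those that lie with `v` in a clique `K` as above
form a subgroup of `ℤ`, so that the other `m` vertices of `K` are acted on as a dihedral group of
degree `m`. -/
theorem exists_dihedral (hL : M.IsLabelling G pt) (hreg : M.IsRegular) {K : Finset V}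
    (hc : ∀ a ∈ K, ∀ b ∈ K, a ≠ b → G.Adj a b)
    (hmax : ∀ a ∈ K, ∀ b ∈ K, a ≠ b → ∀ w, G.Adj a w → G.Adj b w → w ∈ K)
    {m : ℕ} (hm : 1 ≤ m) (hK : K.card = m + 1) {v : V} (hv : v ∈ K) :
    ∃ φ : ZMod m → V, Function.Injective φ ∧ (∀ w, (w ∈ K ∧ w ≠ v) ↔ ∃ j, φ j = w) ∧
      ∀ s c, ∃ g : {h : Equiv.Perm Φ // M.IsAutomorphism h},
        hL.act g v = v ∧ ∀ j, hL.act g (φ j) = φ (dihedralFun s c j) := by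
  classical
  have : Finite Φ := M.finite
  obtain ⟨b, hb, hbv⟩ := Finset.exists_mem_ne (by omega : 1 < K.card) v
  obtain ⟨x, rfl, hxb⟩ := hL.exists_of_adj v b (hc v hv b hb hbv.symm)
  let ν : ℤ → V := fun i => pt (M.r₀ ((M.turn ^ i) x))
  have hν0 : ν 0 = b := hxb
  have hνadj : ∀ i, G.Adj (pt x) (ν i) := fun i => by
    have := hL.adj ((M.turn ^ i) x)
    rwa [hL.pt_turn_zpow] at this
  have hνsurj : ∀ w, G.Adj (pt x) w → ∃ i, ν i = w := by
    intro w hw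
    obtain ⟨y, hy, rfl⟩ := hL.exists_of_adj _ w hw
    obtain ⟨i, rfl | rfl⟩ := (hL.pt_eq_iff _ _).1 hy.symm
    · exact ⟨i, rfl⟩
    · exact ⟨i, by rw [M.r₀_r₂, hL.pt_r₂]⟩
  have hνinj : ∀ i j, ν i = ν j ↔ (orderOf M.turn : ℤ) ∣ i - j := by
    intro i j
    have hij : (M.turn ^ i) x = (M.turn ^ (i - j)) ((M.turn ^ j) x) := by
      rw [← turn_zpow_add, sub_add_cancel]
    rw [orderOf_dvd_iff_zpow_eq_one]
    constructor
    · intro h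
      rcases hL.eq_or_eq _ _ (by rw [hL.pt_turn_zpow, hL.pt_turn_zpow]) h with h | h
      · exact hreg.turn_zpow_eq_one (hij.symm.trans h.symm)
      · rw [hij] at h
        exact absurd h.symm (M.r₂_turn_zpow_ne _ _)
    · intro h
      simp only [ν]
      rw [hij, h, Equiv.Perm.one_apply]
  have hrot : ∀ i : ℤ, ∃ h, M.IsAutomorphism h ∧ hL.act h (pt x) = pt x ∧
      ∀ j, hL.act h (ν j) = ν (i + j) := by
    intro i
    obtain ⟨h, ⟨hh, hx⟩, -⟩ := hreg x ((M.turn ^ i) x)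
    refine ⟨h, hh, by rw [hL.act_pt hh, hx, hL.pt_turn_zpow], fun j => ?_⟩
    rw [hL.act_pt hh, (hh _).1, hh.map_turn_zpow, hx, ← turn_zpow_add, add_comm]
  have hrefl : ∀ i : ℤ, ∃ h, M.IsAutomorphism h ∧ hL.act h (pt x) = pt x ∧
      ∀ j, hL.act h (ν j) = ν (i - j) := by
    intro i
    obtain ⟨h, ⟨hh, hx⟩, -⟩ := hreg x ((M.turn ^ (-i)) (M.r₂ x))
    refine ⟨h, hh, by rw [hL.act_pt hh, hx, hL.pt_turn_zpow, hL.pt_r₂], fun j => ?_⟩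
    rw [hL.act_pt hh, (hh _).1, hh.map_turn_zpow, hx, ← turn_zpow_add,
      show j + -i = -(i - j) by ring, ← r₂_turn_zpow, M.r₀_r₂, hL.pt_r₂]
  let H : AddSubgroup ℤ :=
    { carrier := {i | ν i ∈ K}
      zero_mem' := by simpa only [Set.mem_ofPred_eq, hν0] using hb
      add_mem' := by
        intro i j hi hj
        obtain ⟨h, hh, h1, h2⟩ := hrot i
        simp only [Set.mem_ofPred_eq] at hi hj ⊢
        rw [← h2]
        refine hL.act_mem hc hmax hh hv hb hbv.symm (by rwa [h1]) ?_ hj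
        rwa [← hν0, h2, add_zero]
      neg_mem' := by
        intro i hi
        obtain ⟨h, hh, h1, h2⟩ := hrot (-i)
        simp only [Set.mem_ofPred_eq] at hi ⊢
        rw [← add_zero (-i), ← h2, hν0]
        refine hL.act_mem hc hmax hh hv hi (hνadj i).ne (by rwa [h1]) ?_ hb
        rwa [h2, neg_add_cancel, hν0] }
  obtain ⟨s, hs⟩ : ∃ s : ℕ, ∀ i, ν i ∈ K ↔ (s : ℤ) ∣ i := by
    obtain ⟨a, ha⟩ := Int.subgroup_cyclic H
    refine ⟨a.natAbs, fun i => ?_⟩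
    rw [Int.natAbs_dvd, ← Int.mem_zmultiples_iff, AddSubgroup.zmultiples_eq_closure, ← ha]
    rfl
  obtain ⟨m', hm'⟩ : s ∣ orderOf M.turn := by
    rw [← Int.natCast_dvd_natCast, ← hs, (hνinj _ 0).2 (by simp), hν0]
    exact hb
  have hpos : 0 < s * m' := hm' ▸ orderOf_pos M.turn
  have hs0 : 0 < s := Nat.pos_of_mul_pos_right hpos
  have hm0 : 0 < m' := Nat.pos_of_mul_pos_left hpos
  have : NeZero m' := ⟨hm0.ne'⟩
  have hνs : ∀ i j : ℤ, ν (s * i) = ν (s * j) ↔ (i : ZMod m') = j := by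
    intro i j
    rw [hνinj, hm', ← mul_sub, Nat.cast_mul, mul_dvd_mul_iff_left (by exact_mod_cast hs0.ne'),
      eq_comm, ZMod.intCast_eq_intCast_iff_dvd_sub]
  let φ : ZMod m' → V := fun j => ν (s * (j.cast : ℤ))
  have hφ : ∀ k : ℤ, φ k = ν (s * k) := fun k => (hνs _ _).2 (by simp)
  have hinj : Function.Injective φ := by
    intro i j hij
    simpa using (hνs _ _).1 hij
  have hrange : ∀ w, (w ∈ K ∧ w ≠ pt x) ↔ ∃ j, φ j = w := by
    intro w
    constructor
    · rintro ⟨hw, hwx⟩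
      obtain ⟨i, rfl⟩ := hνsurj w (hc _ hv _ hw hwx.symm)
      obtain ⟨k, rfl⟩ := (hs i).1 hw
      exact ⟨k, hφ k⟩
    · rintro ⟨j, rfl⟩
      exact ⟨(hs _).2 (dvd_mul_right _ _), (hνadj _).ne'⟩
  obtain rfl : m' = m := by
    have h1 : K.erase (pt x) = Finset.univ.image φ := by
      ext w
      rw [Finset.mem_erase, and_comm, hrange]
      simp
    have h2 := congrArg Finset.card h1
    rw [Finset.card_erase_of_mem hv, hK, Finset.card_image_of_injective _ hinj, Finset.card_univ,
      ZMod.card] at h2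
    omega
  refine ⟨φ, hinj, hrange, fun t c => ?_⟩
  obtain ⟨c, rfl⟩ := ZMod.intCast_surjective c
  cases t
  · obtain ⟨h, hh, h1, h2⟩ := hrot (s * c)
    refine ⟨⟨h, hh⟩, h1, fun j => ?_⟩
    obtain ⟨j, rfl⟩ := ZMod.intCast_surjective j
    rw [dihedralFun, if_neg Bool.false_ne_true, ← Int.cast_add, hφ, hφ, h2, mul_add]
  · obtain ⟨h, hh, h1, h2⟩ := hrefl (s * c)
    refine ⟨⟨h, hh⟩, h1, fun j => ?_⟩
    obtain ⟨j, rfl⟩ := ZMod.intCast_surjective j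
    rw [dihedralFun, if_pos rfl, ← Int.cast_sub, hφ, hφ, h2, mul_sub]

end IsLabelling

end CombinatorialMap

/-! ### Lines of the Hamming graph -/

/-- The vertices of the line through the origin in the direction of the coordinate `i`. -/
def hammingLine {d : ℕ} (n : ℕ) [NeZero n] (i : Fin d) : Finset (Fin d → Fin n) :=
  Finset.univ.image (Function.update (0 : Fin d → Fin n) i)

section hammingLine

variable {d n : ℕ} [NeZero n] {i : Fin d}

theorem mem_hammingLine {w : Fin d → Fin n} : w ∈ hammingLine n i ↔ ∀ j ≠ i, w j = 0 := by
  simp only [hammingLine, Finset.mem_image, Finset.mem_univ, true_and]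
  constructor
  · rintro ⟨k, rfl⟩ j hj
    simp [hj]
  · intro h
    refine ⟨w i, ?_⟩
    ext j
    by_cases hj : j = i
    · subst hj; simp
    · simp [hj, h j hj]

theorem card_hammingLine : (hammingLine n i).card = n := by
  rw [hammingLine, Finset.card_image_of_injective _ (Function.update_injective _ _),
    Finset.card_univ, Fintype.card_fin]

theorem hammingLine_ne {a b : Fin d → Fin n} (ha : a ∈ hammingLine n i)
    (hb : b ∈ hammingLine n i) (hab : a ≠ b) : a i ≠ b i := by
  rw [mem_hammingLine] at ha hb
  intro h
  apply hab
  ext j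
  by_cases hj : j = i
  · rw [hj, h]
  · rw [ha j hj, hb j hj]

theorem hammingLine_adj {a b : Fin d → Fin n} (ha : a ∈ hammingLine n i)
    (hb : b ∈ hammingLine n i) (hab : a ≠ b) : (hammingGraph d n).Adj a b := by
  refine ⟨i, hammingLine_ne ha hb hab, fun j hj => ?_⟩
  rw [mem_hammingLine] at ha hb
  by_contra hji
  exact hj (by rw [ha j hji, hb j hji])

theorem mem_hammingLine_of_adj {a b w : Fin d → Fin n} (ha : a ∈ hammingLine n i)
    (hb : b ∈ hammingLine n i) (hab : a ≠ b) (haw : (hammingGraph d n).Adj a w)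
    (hbw : (hammingGraph d n).Adj b w) : w ∈ hammingLine n i := by
  have hi := hammingLine_ne ha hb hab
  rw [mem_hammingLine] at ha hb ⊢
  intro j hj
  obtain ⟨k, -, hk⟩ := haw
  obtain ⟨l, -, hl⟩ := hbw
  by_contra hw
  have hjk := hk j (show a j ≠ w j by rw [ha j hj]; exact Ne.symm hw)
  have hjl := hl j (show b j ≠ w j by rw [hb j hj]; exact Ne.symm hw)
  -- Both `a` and `b` differ from `w` only in the coordinate `j`.
  apply hi
  have h1 : a i = w i := by
    by_contra h
    exact hj (hjk.trans (hk i h).symm)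
  have h2 : b i = w i := by
    by_contra h
    exact hj (hjl.trans (hl i h).symm)
  rw [h1, h2]

end hammingLine

theorem corollary3p2 {Φ : Type*} (d n : ℕ) (hd : 2 ≤ d) (hn : 3 ≤ n)
    (M : CombinatorialMap Φ) (hM : M.IsEmbeddingOf (hammingGraph d n))
    (hreg : M.IsRegular) (hnonor : ¬ M.IsOrientable) :
    n = 3 ∨ n = 4 ∨ n = 6 := by
  by_cases hn3 : n = 3
  · exact Or.inl hn3
  obtain ⟨m, rfl⟩ : ∃ m, n = m + 1 := ⟨n - 1, by omega⟩
  obtain ⟨pt, hL⟩ := hM.exists_isLabelling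
  let i : Fin d := ⟨0, by omega⟩
  have : Nonempty {h : Equiv.Perm Φ // M.IsAutomorphism h} := ⟨⟨1, fun _ => ⟨rfl, rfl, rfl⟩⟩⟩
  have key := eq_three_or_five_of_dihedral (m := m) (by omega) (hammingLine (m + 1) i)
    card_hammingLine (fun g : {h : Equiv.Perm Φ // M.IsAutomorphism h} => hL.act g)
    (fun a ha b hb hab => hL.exists_swaps hreg (hammingLine_adj ha hb hab))
    (fun v hv => hL.exists_dihedral hreg (fun a ha b hb hab => hammingLine_adj ha hb hab)
      (fun a ha b hb hab w => mem_hammingLine_of_adj ha hb hab) (by omega) card_hammingLine hv)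
  omega
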